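/- Coordinates in $\mathbb R^3$ are $(x,y,z)$, with $z$ vertical. A \emph{box} is a non-degenerate closed cuboid with edges parallel to the coordinate axes. An \emph{orthogonal polyhedron} is a connected $3$-manifold with boundary in $\mathbb R^3$ that is a union of finitely many boxes; a \emph{reflex edge} is an edge with interior dihedral angle $270^\circ$. Consider orthogonal polyhedra with no vertical reflex edges. Such a polyhedron has a unique partition into maximal boxes, called \emph{bricks}, any two of which are either disjoint or touch only at the top face of one and the bottom face of the other; a non-empty intersection of two bricks is a \emph{contact rectangle}. A contact rectangle is \emph{primitive} if exactly one of its four sides is a reflex edge, i.e. if the vertical projection of one of the two bricks is a rectangle contained in that of the other, with three of its sides lying on the sides of the latter and the fourth side strictly inside. A \emph{castle} is such a polyhedron in which all contact rectangles are primitive and every brick has either zero or two bricks attached to its top face. A \emph{prism} is the product of a planar region and a segment parallel to a coordinate axis. A \emph{closed} (resp. \emph{open}) \emph{reflex edge guard} is a reflex edge with (resp. without) its two endpoints. A set of guards \emph{guards} $\mathcal C$ if for every $p\in\mathcal C$ there is a point $q$ of some guard such that the segment $pq$ is contained in $\mathcal C$. \textbf{Lemma.} Let $r\ge 0$ be an integer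 and let $\mathcal C$ be a castle with exactly $2r$ reflex edges that is not a prism. Then $\mathcal C$ can be guarded by at most $r$ open reflex edge guards, and also by at most $r$ closed reflex edge guards. -/

import Mathlib

open scoped Topology

namespace OrthoPoly

/-- Points of three-dimensional space; coordinate `2` is the vertical one. Only the affine and
topological structure is used. -/
abbrev Point : Type := Fin 3 → ℝ

/-- A box: a non-degenerate cuboid whose edges are parallel to the coordinate axes. -/
structure Box where
  /-- the corner with the smallest coordinates -/
  lo : Point
  /-- the corner with the largest coordinates -/
  hi : Point
  lt : ∀ i, lo i < hi i

/-- The (closed) set of points of a box. -/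
def Box.carrier (b : Box) : Set Point := {p | ∀ i, b.lo i ≤ p i ∧ p i ≤ b.hi i}

/-- An orthogonal polyhedron: a connected topological 3-manifold with boundary in space that is the
union of finitely many boxes. -/
def IsOrthogonalPolyhedron (P : Set Point) : Prop :=
  IsConnected P ∧
  Nonempty (ChartedSpace (EuclideanHalfSpace 3) P) ∧
  ∃ S : Set Box, S.Finite ∧ P = ⋃ b ∈ S, b.carrier

/-- `p` is a point in the relative interior of a reflex edge of `P` parallel to axis `i`: near `p`,
the set `P` is the complement of an open quarter-space (a right-angled wedge) whose edge is the line
through `p` parallel to axis `i`. Equivalently, the interior dihedral angle at `p` is 270 degrees. -/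
def IsReflexPoint (P : Set Point) (i : Fin 3) (p : Point) : Prop :=
  ∃ s : Fin 3 → ℝ, (∀ j, s j = 1 ∨ s j = -1) ∧
    ∀ᶠ q in 𝓝 p, (q ∈ P ↔ ∃ j, j ≠ i ∧ s j * (q j - p j) ≤ 0)

/-- The reflex edges of `P`. An edge is given by its two endpoints, ordered so that the only
coordinate in which they differ is smaller in the first one; it is a maximal axis-parallel segment
whose relative interior consists of reflex points. -/
def reflexEdges (P : Set Point) : Set (Point × Point) :=
  {e | ∃ i : Fin 3, e.1 i < e.2 i ∧ (∀ j, j ≠ i → e.1 j = e.2 j) ∧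
    (∀ p ∈ openSegment ℝ e.1 e.2, IsReflexPoint P i p) ∧
    ¬ IsReflexPoint P i e.1 ∧ ¬ IsReflexPoint P i e.2}

/-- A 2-reflex orthogonal polyhedron, placed so that all its reflex edges are horizontal. -/
def IsTwoReflex (P : Set Point) : Prop :=
  IsOrthogonalPolyhedron P ∧ ∀ e ∈ reflexEdges P, e.1 2 = e.2 2

/-- `B` is the partition of `P` into bricks: cuboids any two of which are disjoint or touch at a top
and a bottom face only, and which are maximal (no two of them merge into a single cuboid). -/
def IsBrickPartition (P : Set Point) (B : Set Box) : Prop :=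
  B.Finite ∧ P = (⋃ b ∈ B, b.carrier) ∧
  (∀ b ∈ B, ∀ b' ∈ B, b ≠ b' →
    Disjoint b.carrier b'.carrier ∨ b.hi 2 = b'.lo 2 ∨ b'.hi 2 = b.lo 2) ∧
  (∀ b ∈ B, ∀ b' ∈ B, b ≠ b' → ∀ c : Box, c.carrier ≠ b.carrier ∪ b'.carrier)

/-- The box `b'` is attached to the top face of the box `b`: they meet (in their contact rectangle),
and the bottom face of `b'` is at the height of the top face of `b`. -/
def IsAttachedOnTop (b b' : Box) : Prop :=
  b'.lo 2 = b.hi 2 ∧ (b.carrier ∩ b'.carrier).Nonempty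

/-- The vertical projection of `c` is a rectangle inside that of `p` that has three sides on the
sides of the latter, while the fourth side (the one orthogonal to the horizontal axis `i`) is
strictly inside. -/
def IsPrimitiveChild (c p : Box) : Prop :=
  ∃ i : Fin 3, i ≠ 2 ∧
    (∀ j, j ≠ i → j ≠ 2 → c.lo j = p.lo j ∧ c.hi j = p.hi j) ∧
    ((c.lo i = p.lo i ∧ c.hi i < p.hi i) ∨ (p.lo i < c.lo i ∧ c.hi i = p.hi i))

/-- The contact rectangle of two touching bricks, `b` below and `b'` above, is primitive: exactly one
of its four sides is a reflex edge. Either brick may be the larger one. -/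
def IsPrimitiveContact (b b' : Box) : Prop :=
  IsPrimitiveChild b' b ∨ IsPrimitiveChild b b'

/-- `P` is a stack with brick partition `B`: a 2-reflex orthogonal polyhedron all of whose contact
rectangles are primitive. -/
def IsStackWith (P : Set Point) (B : Set Box) : Prop :=
  IsTwoReflex P ∧ IsBrickPartition P B ∧
  ∀ b ∈ B, ∀ b' ∈ B, IsAttachedOnTop b b' → IsPrimitiveContact b b'

/-- A castle: a stack in which every brick has zero or two bricks attached to its top face. -/
def IsCastle (P : Set Point) : Prop :=
  ∃ B : Set Box, IsStackWith P B ∧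
    ∀ b ∈ B, {b' ∈ B | IsAttachedOnTop b b'}.encard = 0 ∨
      {b' ∈ B | IsAttachedOnTop b b'}.encard = 2

/-- An (orthogonal) prism: the product of a planar set `A` and a non-degenerate closed interval
along some coordinate axis `i`. -/
def IsPrism (P : Set Point) : Prop :=
  ∃ (i : Fin 3) (a b : ℝ) (A : Set ({j : Fin 3 // j ≠ i} → ℝ)), a < b ∧
    P = {p | (fun j : {j : Fin 3 // j ≠ i} => p j) ∈ A ∧ a ≤ p i ∧ p i ≤ b}

/-- Two points see each other in `P` if the segment joining them lies in `P`. -/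
def Sees (P : Set Point) (x y : Point) : Prop := segment ℝ x y ⊆ P

/-- Every point of `P` is seen by some point of some guard, for at most `n` guards, each placed on a
reflex edge of `P`; `extent a b` is the set of points of the guard on the edge with endpoints `a`
and `b`. -/
def GuardableByReflexEdges (P : Set Point) (extent : Point → Point → Set Point) (n : ℕ) : Prop :=
  ∃ G : Finset (Point × Point), (∀ e ∈ G, e ∈ reflexEdges P) ∧ G.card ≤ n ∧
    ∀ p ∈ P, ∃ e ∈ G, ∃ x ∈ extent e.1 e.2, Sees P x p

/-- `P` is guardable by at most `n` closed reflex edge guards. -/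
def GuardableByClosed (P : Set Point) (n : ℕ) : Prop :=
  GuardableByReflexEdges P (fun a b => segment ℝ a b) n

/-- `P` is guardable by at most `n` open reflex edge guards (segments without their endpoints). -/
def GuardableByOpen (P : Set Point) (n : ℕ) : Prop :=
  GuardableByReflexEdges P (fun a b => openSegment ℝ a b) n

end OrthoPoly

/-!
The bricks of a castle form a binary tree whose root is the lowest brick. Every inner node is a
*fork*: the two bricks on its top face sit at its two ends along one horizontal axis `i` and fill it
along the other, so a fork carries two reflex edges orthogonal to `i`, and `n` forks give at least
`2 * n` reflex edges.

Every brick of a tower projects into its root and has a solid column below it down to the root.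
Hence an edge of the root with coordinate `t` along `i` sees every brick whose extent along `i`
contains `t`. Suppose the bricks that reach the plane `x i = t` through one end of the root are
already guarded. Then one more edge per fork along `i` suffices: at such a fork the edge facing the
far child guards that child's bricks at its inner end, while forks along the other axis cost none.
If the root forks along `i`, its two edges start this process in both children, one edge more than
there are forks along `i`. So there are enough guards as soon as some fork is along the other
axis `j`, and otherwise all bricks have the same extent along `j` and the castle is a prism.
-/

namespace OrthoPoly

open Set Function

/-- `i` and `j` are the two horizontal coordinate axes, in some order. -/
structure AreHorizontalAxes (i j : Fin 3) : Prop where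
  ne : i ≠ j
  fst_ne_two : i ≠ 2
  snd_ne_two : j ≠ 2

namespace AreHorizontalAxes

variable {i j : Fin 3}

theorem exists_of_ne_two (hi : i ≠ 2) : ∃ j, AreHorizontalAxes i j := by
  obtain ⟨j, hij, hj⟩ : ∃ j, i ≠ j ∧ j ≠ 2 := by decide +revert
  exact ⟨j, hij, hi, hj⟩

theorem eq_or_eq (h : AreHorizontalAxes i j) {k : Fin 3} (hk : k ≠ 2) : k = i ∨ k = j := by
  obtain ⟨h₁, h₂, h₃⟩ := h
  omega

theorem eq_or_swap (h : AreHorizontalAxes i j) {k l : Fin 3} (h' : AreHorizontalAxes k l) :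
    (k = i ∧ l = j) ∨ (k = j ∧ l = i) := by
  have := h.eq_or_eq h'.fst_ne_two
  have := h.eq_or_eq h'.snd_ne_two
  have := h'.ne
  omega

theorem forall_ne_two_iff (h : AreHorizontalAxes i j) {Q : Fin 3 → Prop} :
    (∀ k, k ≠ 2 → Q k) ↔ Q i ∧ Q j := by
  refine ⟨fun hQ => ⟨hQ i h.fst_ne_two, hQ j h.snd_ne_two⟩, fun ⟨hi, hj⟩ k hk => ?_⟩
  rcases h.eq_or_eq hk with rfl | rfl <;> assumption

theorem forall_iff (h : AreHorizontalAxes i j) {Q : Fin 3 → Prop} :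
    (∀ k, Q k) ↔ Q i ∧ Q j ∧ Q 2 := by
  rw [← and_assoc, ← h.forall_ne_two_iff]
  refine ⟨fun hQ => ⟨fun k _ => hQ k, hQ 2⟩, fun ⟨hQ, h₂⟩ k => ?_⟩
  by_cases hk : k = 2
  · exact hk ▸ h₂
  · exact hQ k hk

theorem exists_ne_snd_iff (h : AreHorizontalAxes i j) {Q : Fin 3 → Prop} :
    (∃ k, k ≠ j ∧ Q k) ↔ Q i ∨ Q 2 := by
  refine ⟨fun ⟨k, hk, hQ⟩ => ?_, ?_⟩
  · by_cases hk₂ : k = 2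
    · exact Or.inr (hk₂ ▸ hQ)
    · exact Or.inl ((h.eq_or_eq hk₂).resolve_right hk ▸ hQ)
  · rintro (hQ | hQ)
    exacts [⟨i, h.ne, hQ⟩, ⟨2, h.snd_ne_two.symm, hQ⟩]

theorem add_le_sum (h : AreHorizontalAxes i j) (n : Fin 3 → ℕ) : n i + n j ≤ ∑ k, n k := by
  rw [← Finset.sum_pair h.ne]
  exact Finset.sum_le_univ_sum_of_nonneg fun _ => Nat.zero_le _

end AreHorizontalAxes

namespace Box

/-- The extent of a box along the axis `k`. -/
def side (b : Box) (k : Fin 3) : Set ℝ := Icc (b.lo k) (b.hi k)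

theorem lo_mem_side (b : Box) (k : Fin 3) : b.lo k ∈ b.side k := left_mem_Icc.2 (b.lt k).le

theorem hi_mem_side (b : Box) (k : Fin 3) : b.hi k ∈ b.side k := right_mem_Icc.2 (b.lt k).le

theorem mem_side_of_eq_or_eq {b : Box} {k : Fin 3} {t : ℝ} (ht : t = b.lo k ∨ t = b.hi k) :
    t ∈ b.side k := by
  rcases ht with rfl | rfl
  exacts [b.lo_mem_side k, b.hi_mem_side k]

theorem side_eq_iff {b c : Box} {k : Fin 3} :
    b.side k = c.side k ↔ b.lo k = c.lo k ∧ b.hi k = c.hi k :=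
  Icc_eq_Icc_iff (b.lt k).le

theorem lo_mem (b : Box) : b.lo ∈ b.carrier := b.lo_mem_side

theorem carrier_eq_Icc (b : Box) : b.carrier = Icc b.lo b.hi := by
  ext p
  exact forall_and

theorem isClosed_carrier (b : Box) : IsClosed b.carrier := b.carrier_eq_Icc ▸ isClosed_Icc

theorem inter_nonempty_iff {b c : Box} :
    (b.carrier ∩ c.carrier).Nonempty ↔ ∀ k, (b.side k ∩ c.side k).Nonempty :=
  ⟨fun ⟨p, hb, hc⟩ k => ⟨p k, hb k, hc k⟩, fun h => by
    choose p hp using h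
    exact ⟨p, fun k => (hp k).1, fun k => (hp k).2⟩⟩

theorem eventually_apply_mem_side {b : Box} {k : Fin 3} {p : Point}
    (hp : p k ∈ Ioo (b.lo k) (b.hi k)) : ∀ᶠ q in 𝓝 p, q k ∈ b.side k :=
  (continuous_apply k).continuousAt.eventually_mem (Icc_mem_nhds hp.1 hp.2)

/-- The column over the base rectangle of `w` from height `z` to the top of `w`. -/
def column (w : Box) (z : ℝ) : Set Point := Icc (update w.lo 2 z) w.hi

theorem mem_column {w : Box} {z : ℝ} {p : Point} :
    p ∈ w.column z ↔ (∀ k, k ≠ 2 → p k ∈ w.side k) ∧ p 2 ∈ Icc z (w.hi 2) := by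
  simp only [column, side, mem_Icc, Pi.le_def]
  grind

theorem carrier_subset_column {w : Box} {z : ℝ} (hz : z ≤ w.lo 2) : w.carrier ⊆ w.column z :=
  fun _ hp => mem_column.2 ⟨fun k _ => hp k, hz.trans (hp 2).1, (hp 2).2⟩

end Box

/-- The solid made of the boxes in `B`. -/
abbrev solid (B : Set Box) : Set Point := ⋃ b ∈ B, b.carrier

theorem carrier_subset_solid {B : Set Box} {b : Box} (hb : b ∈ B) : b.carrier ⊆ solid B :=
  subset_biUnion_of_mem hb

theorem eventually_mem_solid_iff {B : Set Box} (hfin : B.Finite) (p : Point) :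
    ∀ᶠ q in 𝓝 p, q ∈ solid B ↔ ∃ b ∈ B, p ∈ b.carrier ∧ q ∈ b.carrier := by
  have hfar : ∀ᶠ q in 𝓝 p, ∀ b ∈ B, p ∉ b.carrier → q ∉ b.carrier := by
    rw [hfin.eventually_all]
    exact fun b _ => Filter.eventually_imp_distrib_left.2 fun hp =>
      b.isClosed_carrier.isOpen_compl.mem_nhds hp
  filter_upwards [hfar] with q hq
  simp only [mem_iUnion, exists_prop]
  exact exists_congr fun b => and_congr_right fun hb =>
    ⟨fun hqb => ⟨not_imp_not.1 (hq b hb) hqb, hqb⟩, And.right⟩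

theorem isPrism_solid {B : Set Box} {v : Box} {j : Fin 3} (h : ∀ w ∈ B, w.side j = v.side j) :
    IsPrism (solid B) := by
  refine ⟨j, v.lo j, v.hi j, {q | ∃ w ∈ B, ∀ k : {k : Fin 3 // k ≠ j}, q k ∈ w.side k}, v.lt j, ?_⟩
  ext p
  simp only [mem_iUnion, exists_prop, mem_ofPred_eq]
  constructor
  · rintro ⟨w, hw, hp⟩
    exact ⟨⟨w, hw, fun k => hp k⟩, (h w hw).subset (hp j)⟩
  · rintro ⟨⟨w, hw, hp⟩, hpj⟩
    refine ⟨w, hw, fun k => ?_⟩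
    by_cases hk : k = j
    · subst hk
      exact (h w hw).superset hpj
    · exact hp ⟨k, hk⟩

theorem IsReflexPoint.congr {P Q : Set Point} {i : Fin 3} {p : Point}
    (hPQ : ∀ᶠ q in 𝓝 p, q ∈ P ↔ q ∈ Q) : IsReflexPoint P i p ↔ IsReflexPoint Q i p :=
  exists_congr fun _ => and_congr_right fun _ =>
    Filter.eventually_congr (hPQ.mono fun _ h => by rw [h])

theorem IsReflexPoint.eventually_update_mem {P : Set Point} {i : Fin 3} {p : Point}
    (h : IsReflexPoint P i p) : ∀ᶠ x in 𝓝 (p i), update p i x ∈ P := by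
  obtain ⟨s, -, hs⟩ := h
  obtain ⟨k, hk⟩ := exists_ne i
  have hcont : Continuous (update p i) := continuous_const.update i continuous_id
  have htends : Filter.Tendsto (update p i) (𝓝 (p i)) (𝓝 p) := by
    simpa only [update_eq_self] using hcont.tendsto (p i)
  filter_upwards [htends.eventually hs] with x hx
  exact hx.2 ⟨k, hk, by simp [hk]⟩

section Ridge

variable {i j : Fin 3}

/-- The point of the plane of the top face of `v` with coordinates `t` along `i` and `y` along `j`,
where `i` and `j` are the horizontal axes. -/
def ridgePoint (v : Box) (i j : Fin 3) (t y : ℝ) : Point := update (update v.hi i t) j y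

/-- The segment that crosses the top face of `v` from side to side along `j` and has coordinate `t`
along `i`, where `i` and `j` are the horizontal axes. -/
def ridge (v : Box) (i j : Fin 3) (t : ℝ) : Point × Point :=
  (ridgePoint v i j t (v.lo j), ridgePoint v i j t (v.hi j))

theorem ridgePoint_fst (hij : AreHorizontalAxes i j) (v : Box) (t y : ℝ) :
    ridgePoint v i j t y i = t := by
  simp [ridgePoint, hij.ne]

theorem ridgePoint_snd (v : Box) (i j : Fin 3) (t y : ℝ) : ridgePoint v i j t y j = y := by
  simp [ridgePoint]

theorem ridgePoint_two (hij : AreHorizontalAxes i j) (v : Box) (t y : ℝ) :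
    ridgePoint v i j t y 2 = v.hi 2 := by
  simp [ridgePoint, hij.fst_ne_two.symm, hij.snd_ne_two.symm]

theorem openSegment_ridge (v : Box) (i j : Fin 3) (t : ℝ) :
    openSegment ℝ (ridge v i j t).1 (ridge v i j t).2 =
      ridgePoint v i j t '' Ioo (v.lo j) (v.hi j) := by
  rw [← openSegment_eq_Ioo (v.lt j)]
  exact (Pi.image_update_openSegment j _ _ _).symm

end Ridge

/-- Any two boxes in `B` are disjoint, or one ends at the height at which the other begins. -/
def IsStacked (B : Set Box) : Prop :=
  ∀ b ∈ B, ∀ b' ∈ B, b ≠ b' →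
    Disjoint b.carrier b'.carrier ∨ b.hi 2 = b'.lo 2 ∨ b'.hi 2 = b.lo 2

namespace IsStacked

variable {B : Set Box} {b c : Box} {p : Point}

theorem attached_or_attached (hB : IsStacked B) (hb : b ∈ B) (hc : c ∈ B) (hne : b ≠ c)
    (hpb : p ∈ b.carrier) (hpc : p ∈ c.carrier) : IsAttachedOnTop b c ∨ IsAttachedOnTop c b := by
  rcases hB b hb c hc hne with hdisj | h | h
  · exact (disjoint_left.1 hdisj hpb hpc).elim
  · exact Or.inl ⟨h.symm, p, hpb, hpc⟩
  · exact Or.inr ⟨h.symm, p, hpc, hpb⟩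

theorem eq_of_lo_two_eq (hB : IsStacked B) (hb : b ∈ B) (hc : c ∈ B) (h : b.lo 2 = c.lo 2)
    (hpb : p ∈ b.carrier) (hpc : p ∈ c.carrier) : b = c := by
  by_contra hne
  rcases hB.attached_or_attached hb hc hne hpb hpc with ⟨h', -⟩ | ⟨h', -⟩ <;>
    linarith [b.lt 2, c.lt 2]

theorem eq_of_hi_two_eq (hB : IsStacked B) (hb : b ∈ B) (hc : c ∈ B) (h : b.hi 2 = c.hi 2)
    (hpb : p ∈ b.carrier) (hpc : p ∈ c.carrier) : b = c := by
  by_contra hne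
  rcases hB.attached_or_attached hb hc hne hpb hpc with ⟨h', -⟩ | ⟨h', -⟩ <;>
    linarith [b.lt 2, c.lt 2]

theorem eventually_mem_solid_iff (hB : IsStacked B) (hfin : B.Finite) (hb : b ∈ B) (hc : c ∈ B)
    (h : c.lo 2 = b.hi 2) (hpb : p ∈ b.carrier) (hpc : p ∈ c.carrier) :
    ∀ᶠ q in 𝓝 p, q ∈ solid B ↔ q ∈ b.carrier ∪ c.carrier := by
  have honly : ∀ u ∈ B, p ∈ u.carrier → u = b ∨ u = c := by
    refine fun u hu hpu => or_iff_not_imp_left.2 fun hub => ?_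
    rcases hB.attached_or_attached hu hb hub hpu hpb with ⟨h', -⟩ | ⟨h', -⟩
    · linarith [b.lt 2, (hpu 2).2, (hpc 2).1]
    · exact hB.eq_of_lo_two_eq hu hc (h'.trans h.symm) hpu hpc
  filter_upwards [OrthoPoly.eventually_mem_solid_iff hfin p] with q hq
  rw [hq]
  constructor
  · rintro ⟨u, hu, hpu, hqu⟩
    rcases honly u hu hpu with rfl | rfl
    exacts [Or.inl hqu, Or.inr hqu]
  · rintro (hqb | hqc)
    exacts [⟨b, hb, hpb, hqb⟩, ⟨c, hc, hpc, hqc⟩]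

end IsStacked

/-- `c` stands on the top face of `v` as the smaller brick of a primitive contact: it fills `v`
along the horizontal axis `j` and, along the other one `i`, reaches from one of the ends of `v` to
the coordinate `t`. -/
structure IsWing (v c : Box) (i j : Fin 3) (t : ℝ) : Prop where
  axes : AreHorizontalAxes i j
  lo_two : c.lo 2 = v.hi 2
  side_snd : c.side j = v.side j
  mem_Ioo : t ∈ Ioo (v.lo i) (v.hi i)
  lo_hi_fst : (c.lo i = v.lo i ∧ c.hi i = t) ∨ (c.lo i = t ∧ c.hi i = v.hi i)

theorem IsPrimitiveChild.side_subset {c p : Box} (h : IsPrimitiveChild c p) {k : Fin 3}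
    (hk : k ≠ 2) : c.side k ⊆ p.side k := by
  obtain ⟨i, -, hother, hi⟩ := h
  by_cases hki : k = i
  · subst hki
    apply Icc_subset_Icc <;> rcases hi with hi | hi <;> linarith
  · exact (Box.side_eq_iff.2 (hother k hki hk)).subset

theorem IsPrimitiveChild.exists_isWing {v c : Box} (h : IsPrimitiveChild c v)
    (h₂ : c.lo 2 = v.hi 2) : ∃ i j t, IsWing v c i j t := by
  obtain ⟨i, hi, hother, hends⟩ := h
  obtain ⟨j, hij⟩ := AreHorizontalAxes.exists_of_ne_two hi
  have hj : c.side j = v.side j := Box.side_eq_iff.2 (hother j hij.ne.symm hij.snd_ne_two)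
  rcases hends with ⟨hlo, hhi⟩ | ⟨hlo, hhi⟩
  · exact ⟨i, j, c.hi i, hij, h₂, hj, ⟨hlo ▸ c.lt i, hhi⟩, Or.inl ⟨hlo, rfl⟩⟩
  · exact ⟨i, j, c.lo i, hij, h₂, hj, ⟨hlo, hhi ▸ c.lt i⟩, Or.inr ⟨rfl, hhi⟩⟩

namespace IsWing

variable {v c : Box} {i j : Fin 3} {t : ℝ}

theorem side_subset (h : IsWing v c i j t) : ∀ k, k ≠ 2 → c.side k ⊆ v.side k := by
  refine h.axes.forall_ne_two_iff.2 ⟨?_, h.side_snd.subset⟩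
  obtain ⟨hlo, hhi⟩ := h.mem_Ioo
  apply Icc_subset_Icc <;> rcases h.lo_hi_fst with hc | hc <;> linarith

theorem mem_side (h : IsWing v c i j t) : t ∈ c.side i := by
  rcases h.lo_hi_fst with ⟨-, rfl⟩ | ⟨rfl, -⟩
  exacts [c.hi_mem_side i, c.lo_mem_side i]

theorem lo_mem_carrier (h : IsWing v c i j t) : c.lo ∈ v.carrier := by
  intro k
  by_cases hk : k = 2
  · subst hk
    exact ⟨by linarith [v.lt 2, h.lo_two], h.lo_two.le⟩
  · exact h.side_subset k hk (c.lo_mem_side k)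

theorem ridgePoint_mem_left (h : IsWing v c i j t) {y : ℝ} (hy : y ∈ v.side j) :
    ridgePoint v i j t y ∈ v.carrier := by
  refine h.axes.forall_iff.2 ⟨?_, ?_, ?_⟩
  · exact (ridgePoint_fst h.axes v t y).symm ▸ Ioo_subset_Icc_self h.mem_Ioo
  · exact (ridgePoint_snd v i j t y).symm ▸ hy
  · exact (ridgePoint_two h.axes v t y).symm ▸ v.hi_mem_side 2

theorem ridgePoint_mem_right (h : IsWing v c i j t) {y : ℝ} (hy : y ∈ v.side j) :
    ridgePoint v i j t y ∈ c.carrier := by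
  refine h.axes.forall_iff.2 ⟨?_, ?_, ?_⟩
  · exact (ridgePoint_fst h.axes v t y).symm ▸ h.mem_side
  · exact (ridgePoint_snd v i j t y).symm ▸ h.side_snd.superset hy
  · exact (ridgePoint_two h.axes v t y).symm ▸ h.lo_two ▸ c.lo_mem_side 2

theorem exists_sign (h : IsWing v c i j t) :
    ∃ σ : ℝ, (σ = 1 ∨ σ = -1) ∧ ∀ x ∈ v.side i, x ∈ c.side i ↔ σ * (x - t) ≤ 0 := by
  rcases h.lo_hi_fst with ⟨hlo, hhi⟩ | ⟨hlo, hhi⟩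
  · refine ⟨1, Or.inl rfl, fun x hx => ⟨fun hc => ?_, fun hσ => ⟨hlo ▸ hx.1, ?_⟩⟩⟩
    · linarith [hc.2]
    · linarith
  · refine ⟨-1, Or.inr rfl, fun x hx => ⟨fun hc => ?_, fun hσ => ⟨?_, hhi ▸ hx.2⟩⟩⟩
    · linarith [hc.1]
    · linarith

theorem isReflexPoint_of_mem_Ioo (h : IsWing v c i j t) {y : ℝ} (hy : y ∈ Ioo (v.lo j) (v.hi j)) :
    IsReflexPoint (v.carrier ∪ c.carrier) j (ridgePoint v i j t y) := by
  obtain ⟨σ, hσ, hside⟩ := h.exists_sign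
  set p := ridgePoint v i j t y
  have hpi : p i = t := ridgePoint_fst h.axes v t y
  have hpj : p j = y := ridgePoint_snd v i j t y
  have hp₂ : p 2 = v.hi 2 := ridgePoint_two h.axes v t y
  refine ⟨update 1 i σ, fun k => ?_, ?_⟩
  · by_cases hk : k = i
    · subst hk
      simpa using hσ
    · simp [hk]
  have hqi := v.eventually_apply_mem_side (hpi.symm ▸ h.mem_Ioo)
  have hqj := v.eventually_apply_mem_side (hpj.symm ▸ hy)
  have habove : ∀ᶠ q in 𝓝 p, v.lo 2 < q 2 :=
    (continuous_apply 2).continuousAt.eventually_const_lt (by simpa only [hp₂] using v.lt 2)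
  have hbelow : ∀ᶠ q in 𝓝 p, q 2 < c.hi 2 :=
    (continuous_apply 2).continuousAt.eventually_lt_const
      (by simpa only [hp₂, ← h.lo_two] using c.lt 2)
  filter_upwards [hqi, hqj, habove, hbelow] with q hqi hqj habove hbelow
  have hqv : q ∈ v.carrier ↔ q 2 ≤ v.hi 2 :=
    h.axes.forall_iff.trans ⟨fun hq => hq.2.2.2, fun hq => ⟨hqi, hqj, habove.le, hq⟩⟩
  have hqc : q ∈ c.carrier ↔ σ * (q i - t) ≤ 0 ∧ v.hi 2 ≤ q 2 := by
    rw [← hside _ hqi, ← h.lo_two]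
    exact h.axes.forall_iff.trans ⟨fun hq => ⟨hq.1, hq.2.2.1⟩,
      fun hq => ⟨hq.1, h.side_snd.superset hqj, hq.2, hbelow.le⟩⟩
  rw [mem_union, hqv, hqc, h.axes.exists_ne_snd_iff, hpi, hp₂]
  simp only [update_self, update_of_ne h.axes.fst_ne_two.symm, Pi.one_apply, one_mul, sub_nonpos]
  grind

theorem mem_Ioo_of_isReflexPoint (h : IsWing v c i j t) {y : ℝ}
    (hp : IsReflexPoint (v.carrier ∪ c.carrier) j (ridgePoint v i j t y)) :
    y ∈ Ioo (v.lo j) (v.hi j) := by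
  rw [← interior_Icc, mem_interior_iff_mem_nhds]
  have hnear := hp.eventually_update_mem
  rw [ridgePoint_snd] at hnear
  filter_upwards [hnear] with x hx
  rcases hx with hx | hx
  · simpa [Box.side] using hx j
  · have hxj : x ∈ c.side j := by simpa [Box.side] using hx j
    exact h.side_snd.subset hxj

theorem ridge_mem_reflexEdges {B : Set Box} (hB : IsStacked B) (hfin : B.Finite) (hv : v ∈ B)
    (hc : c ∈ B) (h : IsWing v c i j t) : ridge v i j t ∈ reflexEdges (solid B) := by
  have hreflex : ∀ y ∈ v.side j, IsReflexPoint (solid B) j (ridgePoint v i j t y) ↔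
      y ∈ Ioo (v.lo j) (v.hi j) := fun y hy =>
    (IsReflexPoint.congr (hB.eventually_mem_solid_iff hfin hv hc h.lo_two
      (h.ridgePoint_mem_left hy) (h.ridgePoint_mem_right hy))).trans
        ⟨h.mem_Ioo_of_isReflexPoint, h.isReflexPoint_of_mem_Ioo⟩
  refine ⟨j, ?_, fun k hk => ?_, ?_, ?_, ?_⟩
  · simpa only [ridge, ridgePoint_snd] using v.lt j
  · simp only [ridge, ridgePoint, update_of_ne hk]
  · rw [openSegment_ridge]
    rintro _ ⟨y, hy, rfl⟩
    exact (hreflex y (Ioo_subset_Icc_self hy)).2 hy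
  · exact fun hp => ((hreflex _ (v.lo_mem_side j)).1 hp).1.false
  · exact fun hp => ((hreflex _ (v.hi_mem_side j)).1 hp).2.false

end IsWing

/-- The bricks attached on top of `v` are `a` and `b`, standing at the lower and at the upper end of
`v` along the horizontal axis `i` and both filling `v` along the other horizontal axis `j`. -/
structure IsFork (B : Set Box) (v a b : Box) (i j : Fin 3) : Prop where
  mem : v ∈ B
  left_mem : a ∈ B
  right_mem : b ∈ B
  left : IsWing v a i j (a.hi i)
  right : IsWing v b i j (b.lo i)
  left_lo : a.lo i = v.lo i
  right_hi : b.hi i = v.hi i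
  gap : a.hi i < b.lo i
  attached_iff : ∀ u ∈ B, IsAttachedOnTop v u ↔ u = a ∨ u = b

/-- Every brick in `B` has either no bricks on its top face or the two bricks of a fork. -/
def IsBranching (B : Set Box) : Prop :=
  ∀ v ∈ B, (∀ u ∈ B, ¬ IsAttachedOnTop v u) ∨ ∃ a b i j, IsFork B v a b i j

namespace IsFork

variable {B : Set Box} {v a b c : Box} {i j : Fin 3}

theorem exists_isWing (h : IsFork B v a b i j) (hc : c = a ∨ c = b) : ∃ t, IsWing v c i j t := by
  rcases hc with rfl | rfl
  exacts [⟨_, h.left⟩, ⟨_, h.right⟩]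

theorem eq_of_attached (hB : IsStacked B) (hbr : IsBranching B) (h : IsFork B v a b i j)
    (hc : c ∈ B) (hcab : c = a ∨ c = b) {u : Box} (hu : u ∈ B) (huc : IsAttachedOnTop u c) :
    u = v := by
  rcases hbr u hu with hleaf | ⟨a', b', i', j', h'⟩
  · exact (hleaf c hc huc).elim
  obtain ⟨_, hwing⟩ := h.exists_isWing hcab
  obtain ⟨_, hwing'⟩ := h'.exists_isWing ((h'.attached_iff c hc).1 huc)
  exact hB.eq_of_hi_two_eq hu h.mem (hwing'.lo_two.symm.trans hwing.lo_two)
    hwing'.lo_mem_carrier hwing.lo_mem_carrier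

end IsFork

section ExistsFork

variable {B : Set Box} {v a b : Box} {i j i' j' : Fin 3} {s t : ℝ}

theorem IsAttachedOnTop.isPrimitiveChild (hB : IsStacked B) (ha : a ∈ B) (hb : b ∈ B)
    (hab : a ≠ b) (hva : IsAttachedOnTop v a) (hvb : IsAttachedOnTop v b)
    (h : IsPrimitiveContact v a) : IsPrimitiveChild a v := by
  refine h.resolve_right fun hlarge => hab ?_
  obtain ⟨hb₂, p, hpv, hpb⟩ := hvb
  refine hB.eq_of_lo_two_eq ha hb (hva.1.trans hb₂.symm) (fun k => ?_) hpb
  by_cases hk : k = 2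
  · subst hk
    exact ⟨by linarith [(hpb 2).1, hva.1], by linarith [(hpv 2).2, a.lt 2, hva.1]⟩
  · exact hlarge.side_subset hk (hpv k)

theorem IsWing.inter_nonempty (ha : IsWing v a i j s) (hb : IsWing v b i' j' t)
    (hi : (a.side i ∩ b.side i).Nonempty) (hj : (a.side j ∩ b.side j).Nonempty) :
    (a.carrier ∩ b.carrier).Nonempty :=
  Box.inter_nonempty_iff.2 (ha.axes.forall_iff.2 ⟨hi, hj, a.lo 2, a.lo_mem_side 2,
    (hb.lo_two.trans ha.lo_two.symm) ▸ b.lo_mem_side 2⟩)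

theorem IsWing.axes_eq_of_disjoint (ha : IsWing v a i j s) (hb : IsWing v b i' j' t)
    (hdisj : Disjoint a.carrier b.carrier) : i' = i ∧ j' = j := by
  refine (ha.axes.eq_or_swap hb.axes).resolve_right ?_
  rintro ⟨rfl, rfl⟩
  refine (ha.inter_nonempty hb ?_ ?_).not_disjoint hdisj
  · exact ⟨a.lo j', a.lo_mem_side j',
      hb.side_snd ▸ ha.side_subset j' ha.axes.fst_ne_two (a.lo_mem_side j')⟩
  · exact ⟨b.lo i', ha.side_snd ▸ hb.side_subset i' hb.axes.fst_ne_two (b.lo_mem_side i'),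
      b.lo_mem_side i'⟩

theorem IsWing.isFork_or_isFork (hv : v ∈ B) (ha : a ∈ B) (hb : b ∈ B) (hva : IsWing v a i j s)
    (hvb : IsWing v b i j t) (hdisj : Disjoint a.carrier b.carrier)
    (hatt : ∀ u ∈ B, IsAttachedOnTop v u ↔ u = a ∨ u = b) :
    IsFork B v a b i j ∨ IsFork B v b a i j := by
  have hsides : Disjoint (a.side i) (b.side i) := by
    refine not_not.1 fun hmeet => (hva.inter_nonempty hvb (not_disjoint_iff_nonempty_inter.1 hmeet)
      ⟨v.lo j, ?_, ?_⟩).not_disjoint hdisj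
    exacts [hva.side_snd ▸ v.lo_mem_side j, hvb.side_snd ▸ v.lo_mem_side j]
  rcases hva.lo_hi_fst with ⟨hal, rfl⟩ | ⟨rfl, hah⟩ <;>
    rcases hvb.lo_hi_fst with ⟨hbl, rfl⟩ | ⟨rfl, hbh⟩
  · exact (disjoint_left.1 hsides (a.lo_mem_side i) (hal.trans hbl.symm ▸ b.lo_mem_side i)).elim
  · refine Or.inl ⟨hv, ha, hb, hva, hvb, hal, hbh, lt_of_not_ge fun hle => ?_, hatt⟩
    exact disjoint_left.1 hsides ⟨hal ▸ hvb.mem_Ioo.1.le, hle⟩ (b.lo_mem_side i)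
  · refine Or.inr ⟨hv, hb, ha, hvb, hva, hbl, hah, lt_of_not_ge fun hle => ?_,
      fun u hu => (hatt u hu).trans or_comm⟩
    exact disjoint_left.1 hsides (a.lo_mem_side i) ⟨hbl ▸ hva.mem_Ioo.1.le, hle⟩
  · exact (disjoint_left.1 hsides (a.hi_mem_side i) (hah.trans hbh.symm ▸ b.hi_mem_side i)).elim

theorem exists_isFork (hB : IsStacked B) (hv : v ∈ B)
    (hprim : ∀ u ∈ B, IsAttachedOnTop v u → IsPrimitiveContact v u)
    (htwo : {u ∈ B | IsAttachedOnTop v u}.encard = 2) : ∃ a b i j, IsFork B v a b i j := by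
  obtain ⟨a, b, hab, hset⟩ := encard_eq_two.1 htwo
  obtain ⟨ha, hva⟩ : a ∈ {u ∈ B | IsAttachedOnTop v u} := hset ▸ mem_insert a {b}
  obtain ⟨hb, hvb⟩ : b ∈ {u ∈ B | IsAttachedOnTop v u} := hset ▸ mem_insert_of_mem a rfl
  have hatt : ∀ u ∈ B, IsAttachedOnTop v u ↔ u = a ∨ u = b := fun u hu =>
    (and_iff_right hu).symm.trans (Set.ext_iff.1 hset u)
  have hdisj : Disjoint a.carrier b.carrier := disjoint_left.2 fun p hpa hpb =>
    hab (hB.eq_of_lo_two_eq ha hb (hva.1.trans hvb.1.symm) hpa hpb)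
  obtain ⟨i, j, s, hwa⟩ :=
    (hva.isPrimitiveChild hB ha hb hab hvb (hprim a ha hva)).exists_isWing hva.1
  obtain ⟨i', j', t, hwb⟩ :=
    (hvb.isPrimitiveChild hB hb ha hab.symm hva (hprim b hb hvb)).exists_isWing hvb.1
  obtain ⟨rfl, rfl⟩ := hwa.axes_eq_of_disjoint hwb hdisj
  rcases hwa.isFork_or_isFork hv ha hb hwb hdisj hatt with h | h
  exacts [⟨_, _, _, _, h⟩, ⟨_, _, _, _, h⟩]

theorem isBranching_of_encard (hB : IsStacked B)
    (hprim : ∀ v ∈ B, ∀ u ∈ B, IsAttachedOnTop v u → IsPrimitiveContact v u)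
    (hdeg : ∀ v ∈ B, {u ∈ B | IsAttachedOnTop v u}.encard = 0 ∨
      {u ∈ B | IsAttachedOnTop v u}.encard = 2) : IsBranching B := by
  refine fun v hv => (hdeg v hv).imp (fun hzero u hu hvu => ?_) (exists_isFork hB hv (hprim v hv))
  exact (encard_eq_zero.1 hzero).subset ⟨hu, hvu⟩

end ExistsFork

/-- `w` stands on `v`, possibly through other bricks: it projects into `v`, reaches at least as
high, and the column below it down to the bottom of `v` is contained in `P`. -/
structure StandsOn (P : Set Point) (v w : Box) : Prop where
  side_subset : ∀ k, k ≠ 2 → w.side k ⊆ v.side k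
  lo_two_le : v.lo 2 ≤ w.lo 2
  hi_two_le : v.hi 2 ≤ w.hi 2
  column_subset : w.column (v.lo 2) ⊆ P

/-- Every point of `w` is seen from a point in the relative interior of the segment `e`. -/
def Watches (P : Set Point) (e : Point × Point) (w : Box) : Prop :=
  ∀ p ∈ w.carrier, ∃ x ∈ openSegment ℝ e.1 e.2, Sees P x p

section StandsOn

variable {P : Set Point} {v c w : Box} {i j : Fin 3} {t : ℝ}

theorem StandsOn.refl (hv : v.carrier ⊆ P) : StandsOn P v v where
  side_subset _ _ := Subset.rfl
  lo_two_le := le_rfl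
  hi_two_le := le_rfl
  column_subset := by rwa [Box.column, update_eq_self, ← Box.carrier_eq_Icc]

theorem StandsOn.of_isWing (hv : v.carrier ⊆ P) (hvc : IsWing v c i j t) (h : StandsOn P c w) :
    StandsOn P v w where
  side_subset k hk := (h.side_subset k hk).trans (hvc.side_subset k hk)
  lo_two_le := by linarith [v.lt 2, hvc.lo_two, h.lo_two_le]
  hi_two_le := by linarith [c.lt 2, hvc.lo_two, h.hi_two_le]
  column_subset p hp := by
    obtain ⟨hproj, hlo, hhi⟩ := Box.mem_column.1 hp
    rcases le_total (c.lo 2) (p 2) with hle | hle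
    · exact h.column_subset (Box.mem_column.2 ⟨hproj, hle, hhi⟩)
    · refine hv fun k => ?_
      by_cases hk : k = 2
      · subst hk
        exact ⟨hlo, hvc.lo_two ▸ hle⟩
      · exact hvc.side_subset k hk (h.side_subset k hk (hproj k hk))

theorem StandsOn.watches (h : StandsOn P v w) (hij : AreHorizontalAxes i j) (ht : t ∈ w.side i) :
    Watches P (ridge v i j t) w := by
  intro p hp
  obtain ⟨y, hy⟩ := nonempty_Ioo.2 (w.lt j)
  have hwv : Ioo (w.lo j) (w.hi j) ⊆ Ioo (v.lo j) (v.hi j) :=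
    Ioo_subset_Ioo (h.side_subset j hij.snd_ne_two (w.lo_mem_side j)).1
      (h.side_subset j hij.snd_ne_two (w.hi_mem_side j)).2
  refine ⟨ridgePoint v i j t y, openSegment_ridge v i j t ▸ mem_image_of_mem _ (hwv hy),
    ((convex_Icc _ _).segment_subset ?_ (Box.carrier_subset_column h.lo_two_le hp)).trans
      h.column_subset⟩
  refine Box.mem_column.2 ⟨hij.forall_ne_two_iff.2 ⟨?_, ?_⟩, ?_⟩
  · exact (ridgePoint_fst hij v t y).symm ▸ ht
  · exact (ridgePoint_snd v i j t y).symm ▸ Ioo_subset_Icc_self hy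
  · exact (ridgePoint_two hij v t y).symm ▸ ⟨(v.lt 2).le, h.hi_two_le⟩

end StandsOn

/-- At most `n` reflex edges of `P`, without their endpoints, suffice to guard all boxes in `T`,
each box being watched by a single edge. -/
def BoxesGuardable (P : Set Point) (T : Set Box) (n : ℕ) : Prop :=
  ∃ G : Finset (Point × Point), (∀ e ∈ G, e ∈ reflexEdges P) ∧ G.card ≤ n ∧
    ∀ w ∈ T, ∃ e ∈ G, Watches P e w

namespace BoxesGuardable

variable {P : Set Point} {S T : Set Box} {m n : ℕ}

theorem mono (h : BoxesGuardable P T n) (hST : S ⊆ T) (hnm : n ≤ m) : BoxesGuardable P S m := by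
  obtain ⟨G, hG, hcard, hwatch⟩ := h
  exact ⟨G, hG, hcard.trans hnm, fun w hw => hwatch w (hST hw)⟩

theorem empty (P : Set Point) : BoxesGuardable P ∅ 0 :=
  ⟨∅, by simp, by simp, by simp⟩

theorem of_watches {e : Point × Point} (he : e ∈ reflexEdges P) (h : ∀ w ∈ T, Watches P e w) :
    BoxesGuardable P T 1 :=
  ⟨{e}, by simpa using he, by simp, fun w hw => ⟨e, by simp, h w hw⟩⟩

open Classical in
theorem union (hS : BoxesGuardable P S m) (hT : BoxesGuardable P T n) :
    BoxesGuardable P (S ∪ T) (m + n) := by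
  obtain ⟨G, hG, hGcard, hGS⟩ := hS
  obtain ⟨H, hH, hHcard, hHT⟩ := hT
  refine ⟨G ∪ H, fun e he => (Finset.mem_union.1 he).elim (hG e) (hH e),
    (Finset.card_union_le G H).trans (Nat.add_le_add hGcard hHcard), ?_⟩
  rintro w (hw | hw)
  · exact (hGS w hw).imp fun e he => ⟨Finset.mem_union_left H he.1, he.2⟩
  · exact (hHT w hw).imp fun e he => ⟨Finset.mem_union_right G he.1, he.2⟩

theorem guardableByOpen {B : Set Box} (h : BoxesGuardable (solid B) B n) :
    GuardableByOpen (solid B) n := by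
  obtain ⟨G, hG, hcard, hwatch⟩ := h
  refine ⟨G, hG, hcard, fun p hp => ?_⟩
  obtain ⟨w, hw, hpw⟩ := mem_iUnion₂.1 hp
  obtain ⟨e, he, hew⟩ := hwatch w hw
  exact ⟨e, he, hew p hpw⟩

end BoxesGuardable

theorem GuardableByOpen.guardableByClosed {P : Set Point} {n : ℕ} (h : GuardableByOpen P n) :
    GuardableByClosed P n := by
  obtain ⟨G, hG, hcard, hsee⟩ := h
  refine ⟨G, hG, hcard, fun p hp => ?_⟩
  obtain ⟨e, he, x, hx, hxp⟩ := hsee p hp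
  exact ⟨e, he, x, openSegment_subset_segment ℝ _ _ hx, hxp⟩

/-- The reflex edges of `P` whose first endpoint projects into `v` and is not below the top face
of `v`. -/
def reflexEdgesAbove (P : Set Point) (v : Box) : Set (Point × Point) :=
  {e ∈ reflexEdges P | v.hi 2 ≤ e.1 2 ∧ ∀ k, k ≠ 2 → e.1 k ∈ v.side k}

section ReflexEdgesAbove

variable {P : Set Point} {v c : Box} {i j : Fin 3} {t : ℝ}

theorem IsWing.reflexEdgesAbove_subset (h : IsWing v c i j t) :
    reflexEdgesAbove P c ⊆ reflexEdgesAbove P v := by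
  rintro e ⟨he, hhi, hproj⟩
  exact ⟨he, by linarith [c.lt 2, h.lo_two], fun k hk => h.side_subset k hk (hproj k hk)⟩

theorem IsWing.ridge_mem_reflexEdgesAbove (h : IsWing v c i j t)
    (hmem : ridge v i j t ∈ reflexEdges P) : ridge v i j t ∈ reflexEdgesAbove P v :=
  ⟨hmem, (ridgePoint_two h.axes v t _).ge,
    fun k _ => h.ridgePoint_mem_left (v.lo_mem_side j) k⟩

theorem IsWing.ridge_notMem_reflexEdgesAbove (h : IsWing v c i j t) (s : ℝ) :
    ridge v i j s ∉ reflexEdgesAbove P c := by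
  rintro ⟨-, hhi, -⟩
  have hheight : (ridge v i j s).1 2 = v.hi 2 := ridgePoint_two h.axes v s _
  linarith [c.lt 2, h.lo_two]

theorem IsFork.disjoint_reflexEdgesAbove {B : Set Box} {a b : Box} (h : IsFork B v a b i j) :
    Disjoint (reflexEdgesAbove P a) (reflexEdgesAbove P b) :=
  disjoint_left.2 fun _ ha hb =>
    (h.gap.trans_le (hb.2.2 i h.left.axes.fst_ne_two).1).not_ge (ha.2.2 i h.left.axes.fst_ne_two).2

theorem IsFork.encard_reflexEdgesAbove {B : Set Box} (hB : IsStacked B) (hfin : B.Finite)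
    {a b : Box} (h : IsFork B v a b i j) :
    (reflexEdgesAbove (solid B) a).encard + (reflexEdgesAbove (solid B) b).encard + 2 ≤
      (reflexEdgesAbove (solid B) v).encard := by
  have hne : ridge v i j (a.hi i) ≠ ridge v i j (b.lo i) := fun heq => h.gap.ne <| by
    simpa only [ridge, ridgePoint_fst h.left.axes] using congrArg (fun e => e.1 i) heq
  have hridges : Disjoint (reflexEdgesAbove (solid B) a ∪ reflexEdgesAbove (solid B) b)
      {ridge v i j (a.hi i), ridge v i j (b.lo i)} := by
    simp only [disjoint_insert_right, disjoint_singleton_right, mem_union, not_or]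
    exact ⟨⟨h.left.ridge_notMem_reflexEdgesAbove _, h.right.ridge_notMem_reflexEdgesAbove _⟩,
      h.left.ridge_notMem_reflexEdgesAbove _, h.right.ridge_notMem_reflexEdgesAbove _⟩
  rw [← encard_union_eq h.disjoint_reflexEdgesAbove, ← encard_pair hne, ← encard_union_eq hridges]
  refine encard_le_encard (union_subset
    (union_subset h.left.reflexEdgesAbove_subset h.right.reflexEdgesAbove_subset)
    (pair_subset ?_ ?_))
  · exact h.left.ridge_mem_reflexEdgesAbove
      (h.left.ridge_mem_reflexEdges hB hfin h.mem h.left_mem)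
  · exact h.right.ridge_mem_reflexEdgesAbove
      (h.right.ridge_mem_reflexEdges hB hfin h.mem h.right_mem)

end ReflexEdgesAbove

/-- The bricks above `v`, including `v`, form a binary tree of forks; `T` is the set of these bricks
and `n i` is the number of forks along the axis `i`. -/
inductive IsTower (B : Set Box) : Box → Set Box → (Fin 3 → ℕ) → Prop
  | leaf {v : Box} (hv : v ∈ B) (hnone : ∀ u ∈ B, ¬ IsAttachedOnTop v u) : IsTower B v {v} 0
  | fork {v a b : Box} {i j : Fin 3} {S T : Set Box} {m n : Fin 3 → ℕ}
      (h : IsFork B v a b i j) (ha : IsTower B a S m) (hb : IsTower B b T n) :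
      IsTower B v (insert v (S ∪ T)) (m + n + Pi.single i 1)

theorem exists_isTower {B : Set Box} (hfin : B.Finite) (hbr : IsBranching B) {v : Box}
    (hv : v ∈ B) : ∃ T n, IsTower B v T n := by
  have hwf : B.WellFoundedOn fun c b => b.lo 2 < c.lo 2 :=
    haveI : IsStrictOrder Box fun c b => b.lo 2 < c.lo 2 :=
      { irrefl := fun _ => lt_irrefl _, trans := fun _ _ _ h h' => h'.trans h }
    hfin.wellFoundedOn
  refine hwf.induction (P := fun v => ∃ T n, IsTower B v T n) hv fun v hv ih => ?_
  rcases hbr v hv with hleaf | ⟨a, b, i, j, h⟩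
  · exact ⟨_, _, .leaf hv hleaf⟩
  · obtain ⟨S, m, hS⟩ := ih a h.left_mem (h.left.lo_two ▸ v.lt 2)
    obtain ⟨T, n, hT⟩ := ih b h.right_mem (h.right.lo_two ▸ v.lt 2)
    exact ⟨_, _, .fork h hS hT⟩

namespace IsTower

variable {B : Set Box} {v : Box} {T : Set Box} {n : Fin 3 → ℕ}

theorem root_mem (h : IsTower B v T n) : v ∈ T := by
  cases h with
  | leaf => exact rfl
  | fork => exact mem_insert _ _

theorem subset (h : IsTower B v T n) : T ⊆ B := by
  induction h with
  | leaf hv => exact singleton_subset_iff.2 hv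
  | fork h _ _ iha ihb => exact insert_subset h.mem (union_subset iha ihb)

theorem standsOn (h : IsTower B v T n) : ∀ w ∈ T, StandsOn (solid B) v w := by
  induction h with
  | leaf hv =>
    rintro w rfl
    exact .refl (carrier_subset_solid hv)
  | fork h _ _ iha ihb =>
    have hv := carrier_subset_solid h.mem
    rintro w (rfl | hw | hw)
    exacts [.refl hv, (iha w hw).of_isWing hv h.left, (ihb w hw).of_isWing hv h.right]

theorem attached_mem (h : IsTower B v T n) :
    ∀ w ∈ T, ∀ u ∈ B, IsAttachedOnTop w u → u ∈ T := by
  induction h with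
  | leaf _ hnone =>
    rintro w rfl u hu hwu
    exact (hnone u hu hwu).elim
  | fork h ha hb iha ihb =>
    rintro w (rfl | hw | hw) u hu hwu
    · rcases (h.attached_iff u hu).1 hwu with rfl | rfl
      exacts [Or.inr (Or.inl ha.root_mem), Or.inr (Or.inr hb.root_mem)]
    · exact Or.inr (Or.inl (iha w hw u hu hwu))
    · exact Or.inr (Or.inr (ihb w hw u hu hwu))

theorem eq_root_or_exists_fork (h : IsTower B v T n) :
    ∀ w ∈ T, w = v ∨ ∃ u ∈ T, ∃ a b i j, IsFork B u a b i j ∧ (w = a ∨ w = b) := by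
  induction h with
  | leaf => exact fun w hw => Or.inl hw
  | @fork v a b i j _ _ _ _ h _ _ iha ihb =>
    rintro w (rfl | hw | hw)
    · exact Or.inl rfl
    · rcases iha w hw with rfl | ⟨u, hu, hfork⟩
      exacts [Or.inr ⟨v, mem_insert v _, w, b, i, j, h, Or.inl rfl⟩,
        Or.inr ⟨u, Or.inr (Or.inl hu), hfork⟩]
    · rcases ihb w hw with rfl | ⟨u, hu, hfork⟩
      exacts [Or.inr ⟨v, mem_insert v _, a, w, i, j, h, Or.inr rfl⟩,
        Or.inr ⟨u, Or.inr (Or.inr hu), hfork⟩]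

theorem mem_of_inter_nonempty (hB : IsStacked B) (hbr : IsBranching B) (h : IsTower B v T n)
    (hmin : ∀ u ∈ B, v.lo 2 ≤ u.lo 2) {w u : Box} (hw : w ∈ T) (hu : u ∈ B)
    (hwu : (w.carrier ∩ u.carrier).Nonempty) : u ∈ T := by
  obtain ⟨p, hpw, hpu⟩ := hwu
  by_cases hne : w = u
  · exact hne ▸ hw
  rcases hB.attached_or_attached (h.subset hw) hu hne hpw hpu with hatt | hatt
  · exact h.attached_mem w hw u hu hatt
  rcases h.eq_root_or_exists_fork w hw with rfl | ⟨u', hu', a, b, i, j, hfork, hwab⟩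
  · linarith [hmin u hu, u.lt 2, hatt.1]
  · exact hfork.eq_of_attached hB hbr (h.subset hw) hwab hu hatt ▸ hu'

theorem eq_of_isPreconnected (hB : IsStacked B) (hfin : B.Finite) (hbr : IsBranching B)
    (hconn : IsPreconnected (solid B)) (h : IsTower B v T n)
    (hmin : ∀ u ∈ B, v.lo 2 ≤ u.lo 2) : T = B := by
  have hclosed : ∀ S ⊆ B, IsClosed (solid S) := fun S hS =>
    (hfin.subset hS).isClosed_biUnion fun b _ => b.isClosed_carrier
  refine h.subset.antisymm fun u hu => by_contra fun huT => ?_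
  obtain ⟨p, -, hpT, hpT'⟩ := isPreconnected_closed_iff.1 hconn (solid T) (solid (B \ T))
    (hclosed _ h.subset) (hclosed _ sdiff_subset)
    (by rw [solid, solid, ← biUnion_union, union_sdiff_cancel h.subset])
    ⟨v.lo, mem_biUnion (h.subset h.root_mem) v.lo_mem, mem_biUnion h.root_mem v.lo_mem⟩
    ⟨u.lo, mem_biUnion hu u.lo_mem, mem_biUnion ⟨hu, huT⟩ u.lo_mem⟩
  obtain ⟨w, hw, hpw⟩ := mem_iUnion₂.1 hpT
  obtain ⟨u', hu', hpu'⟩ := mem_iUnion₂.1 hpT'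
  exact hu'.2 (h.mem_of_inter_nonempty hB hbr hmin hw hu'.1 ⟨p, hpw, hpu'⟩)

theorem two_mul_sum_le_encard (hB : IsStacked B) (hfin : B.Finite) (h : IsTower B v T n) :
    ((2 * ∑ k, n k : ℕ) : ℕ∞) ≤ (reflexEdgesAbove (solid B) v).encard := by
  induction h with
  | leaf => simp
  | @fork v a b i j _ _ m n h _ _ iha ihb =>
    calc ((2 * ∑ k, (m + n + Pi.single i 1 : Fin 3 → ℕ) k : ℕ) : ℕ∞)
        = ((2 * ∑ k, m k : ℕ) : ℕ∞) + ((2 * ∑ k, n k : ℕ) : ℕ∞) + 2 := by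
          simp only [Pi.add_apply, Finset.sum_add_distrib, Finset.sum_pi_single', Finset.mem_univ,
            if_true]
          push_cast
          ring
      _ ≤ (reflexEdgesAbove (solid B) a).encard + (reflexEdgesAbove (solid B) b).encard + 2 :=
          add_le_add_left (add_le_add iha ihb) 2
      _ ≤ _ := h.encard_reflexEdgesAbove hB hfin

theorem side_eq_of_eq_zero (h : IsTower B v T n) {j : Fin 3} (hj : j ≠ 2) (hn : n j = 0) :
    ∀ w ∈ T, w.side j = v.side j := by
  induction h with
  | leaf =>
    rintro w rfl
    rfl
  | @fork v a b i' j' _ _ m n h _ _ iha ihb =>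
    have hji : j ≠ i' := by
      rintro rfl
      simp at hn
    obtain rfl : j = j' := (h.left.axes.eq_or_eq hj).resolve_left hji
    obtain ⟨hm, hn⟩ : m j = 0 ∧ n j = 0 := by simpa [hji] using hn
    rintro w (rfl | hw | hw)
    exacts [rfl, (iha hm w hw).trans h.left.side_snd, (ihb hn w hw).trans h.right.side_snd]

theorem boxesGuardable_insert (hB : IsStacked B) (hfin : B.Finite) {c : Box} (h : IsTower B c T n)
    (hv : v ∈ B) {i j : Fin 3} {t : ℝ} (hvc : IsWing v c i j t) {N : ℕ}
    (hoff : BoxesGuardable (solid B) {w ∈ T | t ∉ w.side i} N) :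
    BoxesGuardable (solid B) (insert v T) (N + 1) := by
  have hvB := carrier_subset_solid hv
  have hon : BoxesGuardable (solid B) (insert v {w ∈ T | t ∈ w.side i}) 1 := by
    refine .of_watches (hvc.ridge_mem_reflexEdges hB hfin hv (h.subset h.root_mem)) ?_
    rintro w (rfl | ⟨hw, ht⟩)
    · exact (StandsOn.refl hvB).watches hvc.axes (Ioo_subset_Icc_self hvc.mem_Ioo)
    · exact ((h.standsOn w hw).of_isWing hvB hvc).watches hvc.axes ht
  refine (hoff.union hon).mono ?_ le_rfl
  rintro w (rfl | hw)
  · exact Or.inr (mem_insert w _)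
  · by_cases ht : t ∈ w.side i
    exacts [Or.inr (Or.inr ⟨hw, ht⟩), Or.inl ⟨hw, ht⟩]

theorem boxesGuardable_off (hB : IsStacked B) (hfin : B.Finite) (h : IsTower B v T n)
    {i : Fin 3} (hi : i ≠ 2) {t : ℝ} (ht : t = v.lo i ∨ t = v.hi i) :
    BoxesGuardable (solid B) {w ∈ T | t ∉ w.side i} (n i) := by
  induction h generalizing t with
  | leaf =>
    refine (BoxesGuardable.empty _).mono ?_ le_rfl
    rintro w ⟨rfl, hw⟩
    exact hw (Box.mem_side_of_eq_or_eq ht)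
  | @fork v a b i' j' S T m n h ha hb iha ihb =>
    rcases h.left.axes.eq_or_eq hi with rfl | rfl
    · rcases ht with rfl | rfl
      · have hT := hb.boxesGuardable_insert hB hfin h.mem h.right (ihb (Or.inl rfl))
        refine ((iha (Or.inl h.left_lo.symm)).union hT).mono ?_ (by simp [add_assoc])
        rintro w ⟨rfl | hw | hw, ht⟩
        exacts [Or.inr (mem_insert w _), Or.inl ⟨hw, ht⟩, Or.inr (Or.inr hw)]
      · have hS := ha.boxesGuardable_insert hB hfin h.mem h.left (iha (Or.inr rfl))
        refine (hS.union (ihb (Or.inr h.right_hi.symm))).mono ?_ (by simp; omega)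
        rintro w ⟨rfl | hw | hw, ht⟩
        exacts [Or.inl (mem_insert w _), Or.inl (Or.inr hw), Or.inr ⟨hw, ht⟩]
    · obtain ⟨hal, hah⟩ := Box.side_eq_iff.1 h.left.side_snd
      obtain ⟨hbl, hbh⟩ := Box.side_eq_iff.1 h.right.side_snd
      refine ((iha (t := t) (by rwa [hal, hah])).union (ihb (t := t) (by rwa [hbl, hbh]))).mono ?_
        (by simp)
      rintro w ⟨rfl | hw | hw, hwt⟩
      exacts [(hwt (Box.mem_side_of_eq_or_eq ht)).elim, Or.inl ⟨hw, hwt⟩, Or.inr ⟨hw, hwt⟩]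

theorem isPrism_or_boxesGuardable (hB : IsStacked B) (hfin : B.Finite) (h : IsTower B v T n) :
    IsPrism (solid T) ∨ BoxesGuardable (solid B) T (∑ k, n k) := by
  have hall := h
  cases h with
  | leaf => exact Or.inl (isPrism_solid (hall.side_eq_of_eq_zero (j := 0) (by decide) rfl))
  | @fork v a b i j S T m n h ha hb =>
    have hi := h.left.axes.fst_ne_two
    set N : Fin 3 → ℕ := m + n + Pi.single i 1 with hN
    by_cases hj : N j = 0
    · exact Or.inl (isPrism_solid (hall.side_eq_of_eq_zero h.left.axes.snd_ne_two hj))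
    · have hS := ha.boxesGuardable_insert hB hfin h.mem h.left
        (ha.boxesGuardable_off hB hfin hi (Or.inr rfl))
      have hT := hb.boxesGuardable_insert hB hfin h.mem h.right
        (hb.boxesGuardable_off hB hfin hi (Or.inl rfl))
      have hcount : m i + 1 + (n i + 1) ≤ ∑ k, N k := by
        have hNi : N i = m i + n i + 1 := by simp [hN]
        have := h.left.axes.add_le_sum N
        omega
      refine Or.inr ((hS.union hT).mono ?_ hcount)
      rw [insert_union_distrib]

end IsTower

end OrthoPoly

open Set OrthoPoly

theorem lemmal4 (C : Set OrthoPoly.Point) (r : ℕ) (hC : OrthoPoly.IsCastle C)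
    (hr : (OrthoPoly.reflexEdges C).encard = ((2 * r : ℕ) : ℕ∞))
    (hprism : ¬ OrthoPoly.IsPrism C) :
    OrthoPoly.GuardableByOpen C r ∧ OrthoPoly.GuardableByClosed C r := by
  suffices hopen : GuardableByOpen C r from ⟨hopen, hopen.guardableByClosed⟩
  obtain ⟨B, ⟨⟨⟨hconn, -, -⟩, -⟩, ⟨hfin, rfl, hB, -⟩, hprim⟩, hdeg⟩ := hC
  have hbr : IsBranching B := isBranching_of_encard hB hprim hdeg
  obtain ⟨p, hp⟩ := hconn.nonempty
  obtain ⟨b, hb, -⟩ := mem_iUnion₂.1 hp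
  obtain ⟨v, hv, hmin⟩ := exists_min_image B (fun b => b.lo 2) hfin ⟨b, hb⟩
  obtain ⟨T, n, hT⟩ := exists_isTower hfin hbr hv
  obtain rfl : T = B := hT.eq_of_isPreconnected hB hfin hbr hconn.isPreconnected hmin
  have hforks : ∑ k, n k ≤ r := by
    have hle := (hT.two_mul_sum_le_encard hB hfin).trans (encard_le_encard (sep_subset _ _))
    rw [hr, Nat.cast_le] at hle
    omega
  exact (((hT.isPrism_or_boxesGuardable hB hfin).resolve_left hprism).mono
    Subset.rfl hforks).guardableByOpen
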